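/- We consider logic programs (sets of rules) in which a rule $H \leftarrow L_1,\dots,L_n$ has as head $H$ an atom $p(t_1,\dots,t_m)$, possibly preceded by $\mathit{not}$, or $\bot$ (empty head), and each body literal $L_k$ is an atom $p(t_1,\dots,t_m)$, a comparison $s\prec t$ of terms, or a counting aggregate $s_1\prec_1\#count\{\mathbf t_1:\mathbf L_1;\dots;\mathbf t_n:\mathbf L_n\}\prec_2 s_2$ (either guard may be missing), possibly preceded by $\mathit{not}$; here $\mathbf t_i$ is a tuple of terms and the condition $\mathbf L_i$ is a list of atoms and comparisons, each possibly preceded by $\mathit{not}$. Terms are built from variables, integers, constants and function symbols. A predicate symbol is a name together with an arity. A variable is global in a rule if it occurs in it outside aggregate elements $\mathbf t_i:\mathbf L_i$. A program $P$ is grounded over its Herbrand universe (all integers, and all ground terms built from the constants and function symbols of $P$): global variables of rules are instantiated first, then each aggregate element is replaced by all its ground instances. The count is the number of distinct ground tuples whose condition holds, or $+\infty$ if there are infinitely many. A set $I$ of ground atoms is an answer set of $P$ if it is a minimal model of the reduct of $\mathrm{ground}(P)$ with respect to $I$. The statement holds both when "reduct" means the reduct of ASP-Core-2 (keep exactly the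 rules whose body is true in $I$) and when it means the reduct of Ferraris used for gringo. **Theorem.** Let $b\ge 1$, and let $P$ be a program containing the rule $$ r:\qquad H \leftarrow \bigwedge_{1\le i\le b} F(X_i,\mathbf Z,\mathbf Z'),\ \bigwedge_{1\le i<j\le b} X_i\ne X_j,\ G(\mathbf Z',\mathbf Z''), $$ where $H$ is a head as above, $F$ is a predicate, $X_1,\dots,X_b$ are distinct variables, $\mathbf Z,\mathbf Z',\mathbf Z''$ are pairwise disjoint tuples of variables containing none of the $X_i$, $G(\mathbf Z',\mathbf Z'')$ is a list of literals whose variables occurring outside aggregate elements are exactly those of $\mathbf Z'$ and $\mathbf Z''$, and no $X_i$ occurs in $H$ or (anywhere) in $G$. Let $X$ be a variable that is not in $\mathbf Z,\mathbf Z',\mathbf Z''$ and does not occur in $H$. 1. If $\mathbf Z$ is empty, let $P''$ be obtained from $P$ by replacing $r$ with $$ H \leftarrow b\le \#count\{X: F(X,\mathbf Z')\},\ G(\mathbf Z',\mathbf Z''). $$ Then $P$ and $P''$ have the same answer sets. 2. If $\mathbf Z$ is not empty, let $F'$ be a predicate symbol of arity $|\mathbf Z|$ not occurring in $P$. Let $P'$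 be obtained from $P$ by replacing $r$ with the two rules $$ H \leftarrow \bigwedge_{1\le i\le b} F(X_i,\mathbf Z,\mathbf Z'),\ \bigwedge_{1\le i<j\le b} X_i\ne X_j,\ G(\mathbf Z',\mathbf Z''),\ F'(\mathbf Z), \qquad F'(\mathbf Z)\leftarrow F(X,\mathbf Z,\mathbf Z'), $$ and let $P''$ be obtained from $P$ by replacing $r$ with the two rules $$ H \leftarrow b\le \#count\{X: F(X,\mathbf Z,\mathbf Z')\},\ F'(\mathbf Z),\ G(\mathbf Z',\mathbf Z''), \qquad F'(\mathbf Z)\leftarrow F(X,\mathbf Z,\mathbf Z'). $$ Then $P$, $P'$ and $P''$ have the same answer sets modulo ground atoms $F'(\mathbf z)$: deleting all ground atoms $F'(\mathbf z)$ from an answer set is a bijection from the answer sets of $P'$ onto those of $P$, and also from the answer sets of $P''$ onto those of $P$. -/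

import Mathlib

/-! Non-ground answer set programs with counting aggregates, their grounding over the Herbrand
universe, and their answer sets. -/

namespace ASP

/-- Terms over function symbols `σ` and variables `ν`: variables, integers, and expressions
`f(t₁, …, t_k)`; a symbolic constant is the case `k = 0`. -/
inductive Term (σ ν : Type*) where
  | var (v : ν) : Term σ ν
  | int (n : ℤ) : Term σ ν
  | app {k : ℕ} (f : σ) (ts : Fin k → Term σ ν) : Term σ ν

/-- Ground terms. -/
abbrev GTerm (σ : Type*) := Term σ Empty

namespace Term

variable {σ ν : Type*}

def subst (θ : ν → GTerm σ) : Term σ ν → GTerm σ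
  | var v => θ v
  | int n => int n
  | app f ts => app f (fun i => (ts i).subst θ)

def vars : Term σ ν → Set ν
  | var v => {v}
  | int _ => ∅
  | app _ ts => ⋃ i, (ts i).vars

/-- The function symbols of a term, with their arities. -/
def functors : Term σ ν → Set (σ × ℕ)
  | var _ => ∅
  | int _ => ∅
  | app (k := k) f ts => {(f, k)} ∪ ⋃ i, (ts i).functors

/-- The standard strict total order on ground terms: integers come first, ordered as usual; then
symbolic constants and compound terms, ordered by arity, then by function symbol, then
lexicographically by arguments. -/
inductive Less [LT σ] : GTerm σ → GTerm σ → Prop where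
  | int {m n : ℤ} : m < n → Less (int m) (int n)
  | int_app {m : ℤ} {k : ℕ} {f : σ} {ts : Fin k → GTerm σ} : Less (int m) (app f ts)
  | arity {k l : ℕ} {f g : σ} {ts : Fin k → GTerm σ} {us : Fin l → GTerm σ} :
      k < l → Less (app f ts) (app g us)
  | functor {k : ℕ} {f g : σ} {ts us : Fin k → GTerm σ} :
      f < g → Less (app f ts) (app g us)
  | args {k : ℕ} {f : σ} {ts us : Fin k → GTerm σ} (i : Fin k) :
      (∀ j, j < i → ts j = us j) → Less (ts i) (us i) → Less (app f ts) (app f us)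

instance [LT σ] : LT (GTerm σ) := ⟨Less⟩

end Term

/-- Comparison predicates. -/
inductive Rel where
  | lt | le | eq | ne | gt | ge

def Rel.Holds {α : Type*} [LT α] : Rel → α → α → Prop
  | .lt, x, y => x < y
  | .le, x, y => x < y ∨ x = y
  | .eq, x, y => x = y
  | .ne, x, y => x ≠ y
  | .gt, x, y => y < x
  | .ge, x, y => y < x ∨ x = y

/-! ### Syntax

Everything is parametrised by the predicate names `ρ` and by the type `τ` of terms, so that it
serves both for programs with variables (`τ = Term σ ν`) and for ground ones (`τ = GTerm σ`). -/

/-- `p(t₁, …, t_k)`. The predicate symbol is the name together with the arity `k`. -/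
structure Atom (ρ τ : Type*) where
  pred : ρ
  args : List τ

/-- An atom or a comparison. -/
inductive BasicAtom (ρ τ : Type*) where
  | atom (a : Atom ρ τ) : BasicAtom ρ τ
  | cmp (rel : Rel) (s t : τ) : BasicAtom ρ τ

/-- An atom or a comparison, preceded by `not` if `neg = true`. -/
structure BasicLit (ρ τ : Type*) where
  neg : Bool
  atom : BasicAtom ρ τ

/-- An aggregate element `tuple : cond`. -/
structure Elem (ρ τ : Type*) where
  tuple : List τ
  cond : List (BasicLit ρ τ)

/-- `s₁ ≺₁ #count{elems} ≺₂ s₂`, where either guard may be missing. The type `ε` is that of the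
collection of aggregate elements: a list before grounding, a possibly infinite set after it. -/
structure Count (τ ε : Type*) where
  left : Option (τ × Rel)
  elems : ε
  right : Option (Rel × τ)

/-- A body literal: a basic literal, or a counting aggregate (preceded by `not` if `neg = true`). -/
inductive Literal (ρ τ ε : Type*) where
  | basic (l : BasicLit ρ τ) : Literal ρ τ ε
  | count (neg : Bool) (c : Count τ ε) : Literal ρ τ ε

/-- The nonempty head of a rule: an atom, preceded by `not` if `neg = true`. -/
structure HeadLit (ρ τ : Type*) where
  neg : Bool
  atom : Atom ρ τ

/-- A rule. The head `none` is the empty head `⊥` of a constraint. -/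
structure Rule (ρ τ ε : Type*) where
  head : Option (HeadLit ρ τ)
  body : List (Literal ρ τ ε)

/-- Body literals with variables. -/
abbrev Lit (σ ρ ν : Type*) := Literal ρ (Term σ ν) (List (Elem ρ (Term σ ν)))
/-- A program: a set of rules with variables. -/
abbrev Program (σ ρ ν : Type*) := Set (Rule ρ (Term σ ν) (List (Elem ρ (Term σ ν))))

abbrev GAtom (σ ρ : Type*) := Atom ρ (GTerm σ)
abbrev GCount (σ ρ : Type*) := Count (GTerm σ) (Set (Elem ρ (GTerm σ)))
abbrev GLit (σ ρ : Type*) := Literal ρ (GTerm σ) (Set (Elem ρ (GTerm σ)))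
abbrev GRule (σ ρ : Type*) := Rule ρ (GTerm σ) (Set (Elem ρ (GTerm σ)))

/-! ### Terms and predicates occurring in a program -/

section Occurrences

variable {σ ρ ν τ ε : Type*}

def BasicAtom.terms : BasicAtom ρ τ → Set τ
  | .atom a => {t | t ∈ a.args}
  | .cmp _ s t => {s, t}

def BasicAtom.preds : BasicAtom ρ τ → Set (ρ × ℕ)
  | .atom a => {(a.pred, a.args.length)}
  | .cmp _ _ _ => ∅

def Elem.terms (e : Elem ρ τ) : Set τ :=
  {t | t ∈ e.tuple} ∪ {t | ∃ l ∈ e.cond, t ∈ l.atom.terms}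

def Elem.preds (e : Elem ρ τ) : Set (ρ × ℕ) :=
  {p | ∃ l ∈ e.cond, p ∈ l.atom.preds}

def Count.guardTerms (c : Count τ ε) : Set τ :=
  {t | (∃ g ∈ c.left, t = g.1) ∨ (∃ g ∈ c.right, t = g.2)}

/-- The terms of a literal that stand outside aggregate elements. -/
def Literal.outerTerms : Literal ρ τ ε → Set τ
  | .basic l => l.atom.terms
  | .count _ c => c.guardTerms

/-- All terms of a literal. -/
def Literal.terms : Literal ρ τ (List (Elem ρ τ)) → Set τ
  | .basic l => l.atom.terms
  | .count _ c => c.guardTerms ∪ {t | ∃ e ∈ c.elems, t ∈ e.terms}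

def Literal.preds : Literal ρ τ (List (Elem ρ τ)) → Set (ρ × ℕ)
  | .basic l => l.atom.preds
  | .count _ c => {p | ∃ e ∈ c.elems, p ∈ e.preds}

/-- The terms of a rule head (empty for the head `⊥`). -/
def headTerms (H : Option (HeadLit ρ τ)) : Set τ :=
  {t | ∃ h ∈ H, t ∈ h.atom.args}

def Rule.terms (r : Rule ρ τ (List (Elem ρ τ))) : Set τ :=
  headTerms r.head ∪ {t | ∃ l ∈ r.body, t ∈ l.terms}

def Rule.preds (r : Rule ρ τ (List (Elem ρ τ))) : Set (ρ × ℕ) :=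
  {p | ∃ h ∈ r.head, p = (h.atom.pred, h.atom.args.length)} ∪ {p | ∃ l ∈ r.body, p ∈ l.preds}

/-- The variables that occur in a set of terms. -/
def varsOf (T : Set (Term σ ν)) : Set ν := ⋃ t ∈ T, t.vars

/-- The variables of a rule head. -/
def headVars (H : Option (HeadLit ρ (Term σ ν))) : Set ν := varsOf (headTerms H)

/-- All variables of a literal. -/
def Literal.vars (l : Lit σ ρ ν) : Set ν := varsOf l.terms

/-- The variables that occur in a literal outside aggregate elements. -/
def Literal.globalVars (l : Lit σ ρ ν) : Set ν := varsOf l.outerTerms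

/-- The global variables of a rule: those that occur in it outside aggregate elements. All other
variables are local to the aggregate element they occur in. -/
def Rule.globalVars (r : Rule ρ (Term σ ν) (List (Elem ρ (Term σ ν)))) : Set ν :=
  headVars r.head ∪ {v | ∃ l ∈ r.body, v ∈ l.globalVars}

/-- The predicate symbols (names with arities) that occur in a program. -/
def preds (P : Program σ ρ ν) : Set (ρ × ℕ) := ⋃ r ∈ P, r.preds

/-- The constants and function symbols (names with arities) that occur in a program. -/
def functors (P : Program σ ρ ν) : Set (σ × ℕ) := ⋃ r ∈ P, ⋃ t ∈ r.terms, t.functors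

end Occurrences

/-! ### Grounding -/

section Grounding

variable {σ ρ ν : Type*}

/-- The Herbrand universe: all integers and the ground terms constructible from the constants and
function symbols of the program. -/
inductive InHerbrand (P : Program σ ρ ν) : GTerm σ → Prop where
  | int (n : ℤ) : InHerbrand P (.int n)
  | app {k : ℕ} (f : σ) (ts : Fin k → GTerm σ) :
      (f, k) ∈ functors P → (∀ i, InHerbrand P (ts i)) → InHerbrand P (.app f ts)

def herbrand (P : Program σ ρ ν) : Set (GTerm σ) := {t | InHerbrand P t}

def Atom.subst (θ : ν → GTerm σ) (a : Atom ρ (Term σ ν)) : GAtom σ ρ :=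
  ⟨a.pred, a.args.map (Term.subst θ)⟩

def BasicAtom.subst (θ : ν → GTerm σ) : BasicAtom ρ (Term σ ν) → BasicAtom ρ (GTerm σ)
  | .atom a => .atom (a.subst θ)
  | .cmp rel s t => .cmp rel (s.subst θ) (t.subst θ)

def BasicLit.subst (θ : ν → GTerm σ) (l : BasicLit ρ (Term σ ν)) : BasicLit ρ (GTerm σ) :=
  ⟨l.neg, l.atom.subst θ⟩

def Elem.subst (θ : ν → GTerm σ) (e : Elem ρ (Term σ ν)) : Elem ρ (GTerm σ) :=
  ⟨e.tuple.map (Term.subst θ), e.cond.map (BasicLit.subst θ)⟩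

def HeadLit.subst (θ : ν → GTerm σ) (h : HeadLit ρ (Term σ ν)) : HeadLit ρ (GTerm σ) :=
  ⟨h.neg, h.atom.subst θ⟩

/-- Instantiation of an aggregate: `θ` is applied to the guards, and each aggregate element is
replaced by its instances under all substitutions over the universe `U` that agree with `θ` on the
set `gv` of global variables of the rule. -/
def Count.inst (U : Set (GTerm σ)) (gv : Set ν) (θ : ν → GTerm σ)
    (c : Count (Term σ ν) (List (Elem ρ (Term σ ν)))) : GCount σ ρ where
  left := c.left.map fun g => (g.1.subst θ, g.2)
  elems := {e' | ∃ e ∈ c.elems, ∃ η : ν → GTerm σ,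
    (∀ v, η v ∈ U) ∧ (∀ v ∈ gv, η v = θ v) ∧ e' = e.subst η}
  right := c.right.map fun g => (g.1, g.2.subst θ)

def Literal.inst (U : Set (GTerm σ)) (gv : Set ν) (θ : ν → GTerm σ) : Lit σ ρ ν → GLit σ ρ
  | .basic l => .basic (l.subst θ)
  | .count neg c => .count neg (c.inst U gv θ)

def Rule.inst (U : Set (GTerm σ)) (θ : ν → GTerm σ)
    (r : Rule ρ (Term σ ν) (List (Elem ρ (Term σ ν)))) : GRule σ ρ where
  head := r.head.map (HeadLit.subst θ)
  body := r.body.map (Literal.inst U r.globalVars θ)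

/-- The ground instantiation of a program over its Herbrand universe. -/
def ground (P : Program σ ρ ν) : Set (GRule σ ρ) :=
  {g | ∃ r ∈ P, ∃ θ : ν → GTerm σ, (∀ v, θ v ∈ herbrand P) ∧ g = r.inst (herbrand P) θ}

end Grounding

/-! ### Satisfaction by an interpretation, that is, by a set of ground atoms -/

section Semantics

variable {σ ρ ν : Type*} [LT σ]

def BasicAtom.Sat (I : Set (GAtom σ ρ)) : BasicAtom ρ (GTerm σ) → Prop
  | .atom a => a ∈ I
  | .cmp rel s t => rel.Holds s t

def BasicLit.Sat (I : Set (GAtom σ ρ)) (l : BasicLit ρ (GTerm σ)) : Prop :=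
  match l.neg with
  | false => l.atom.Sat I
  | true => ¬ l.atom.Sat I

open Classical in
/-- The number of elements of a set of term tuples: an integer, or `+∞` (which is greater than
every term) if the set is infinite. -/
noncomputable def countValue (T : Set (List (GTerm σ))) : WithTop (GTerm σ) :=
  if T.Finite then ((Term.int (T.ncard : ℤ) : GTerm σ) : WithTop (GTerm σ)) else ⊤

/-- The guards of the aggregate hold when the counted set of tuples is `T`. -/
def Count.GuardsHold (c : GCount σ ρ) (T : Set (List (GTerm σ))) : Prop :=
  (∀ g ∈ c.left, g.2.Holds (g.1 : WithTop (GTerm σ)) (countValue T)) ∧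
  (∀ g ∈ c.right, g.1.Holds (countValue T) (g.2 : WithTop (GTerm σ)))

def Count.Sat (I : Set (GAtom σ ρ)) (c : GCount σ ρ) : Prop :=
  c.GuardsHold {t | ∃ e ∈ c.elems, e.tuple = t ∧ ∀ l ∈ e.cond, l.Sat I}

def Literal.Sat (I : Set (GAtom σ ρ)) : GLit σ ρ → Prop
  | .basic l => l.Sat I
  | .count false c => c.Sat I
  | .count true c => ¬ c.Sat I

def HeadLit.Sat (I : Set (GAtom σ ρ)) (h : HeadLit ρ (GTerm σ)) : Prop :=
  match h.neg with
  | false => h.atom ∈ I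
  | true => h.atom ∉ I

def Rule.BodySat (I : Set (GAtom σ ρ)) (r : GRule σ ρ) : Prop :=
  ∀ l ∈ r.body, l.Sat I

def Rule.HeadSat (I : Set (GAtom σ ρ)) (r : GRule σ ρ) : Prop :=
  ∃ h ∈ r.head, h.Sat I

def Rule.Sat (I : Set (GAtom σ ρ)) (r : GRule σ ρ) : Prop :=
  r.BodySat I → r.HeadSat I

/-! ### The reduct of ASP-Core-2 (Faber, Leone and Pfeifer) -/

/-- The rules whose body is true in `I`. -/
def flpReduct (Q : Set (GRule σ ρ)) (I : Set (GAtom σ ρ)) : Set (GRule σ ρ) :=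
  {r ∈ Q | r.BodySat I}

/-! ### The reduct of gringo (Ferraris)

The Ferraris reduct of a formula with respect to `I` replaces every maximal subformula that is
false in `I` by `⊥`; negation is a subformula that is evaluated in `I`. The predicates below say
that `K` satisfies the reduct with respect to `I`. An aggregate stands for the conjunction, over
all sets `Δ` of its elements that violate the guards, of the implications from the conjunction of
the conditions in `Δ` to the disjunction of the conditions outside `Δ`. Hence `K` satisfies its
reduct iff the guards hold in `I` and also hold for the elements whose reduced conditions are true
in `K`. -/

def BasicLit.RedSat (I K : Set (GAtom σ ρ)) (l : BasicLit ρ (GTerm σ)) : Prop :=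
  l.Sat I ∧ (l.neg = false → l.atom.Sat K)

def Count.RedSat (I K : Set (GAtom σ ρ)) (c : GCount σ ρ) : Prop :=
  c.Sat I ∧ c.GuardsHold {t | ∃ e ∈ c.elems, e.tuple = t ∧ ∀ l ∈ e.cond, l.RedSat I K}

def Literal.RedSat (I K : Set (GAtom σ ρ)) : GLit σ ρ → Prop
  | .basic l => l.RedSat I K
  | .count false c => c.RedSat I K
  | .count true c => ¬ c.Sat I

def HeadLit.RedSat (I K : Set (GAtom σ ρ)) (h : HeadLit ρ (GTerm σ)) : Prop :=
  h.Sat I ∧ (h.neg = false → h.atom ∈ K)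

def Rule.RedSat (I K : Set (GAtom σ ρ)) (r : GRule σ ρ) : Prop :=
  r.Sat I ∧ ((∀ l ∈ r.body, l.RedSat I K) → ∃ h ∈ r.head, h.RedSat I K)

/-! ### Answer sets -/

/-- The two standard semantics of programs with aggregates. -/
inductive Semantics where
  | aspCore2
  | gringo

/-- `K` is a model of the reduct of the ground program `Q` with respect to `I`. -/
def ReductModel (sem : Semantics) (Q : Set (GRule σ ρ)) (I K : Set (GAtom σ ρ)) : Prop :=
  match sem with
  | .aspCore2 => ∀ r ∈ flpReduct Q I, r.Sat K
  | .gringo => ∀ r ∈ Q, r.RedSat I K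

/-- `I` is an answer set iff it is a minimal model of the reduct of the ground program with
respect to `I`. -/
def answerSets (sem : Semantics) (P : Program σ ρ ν) : Set (Set (GAtom σ ρ)) :=
  {I | Minimal (ReductModel sem (ground P) I) I}

end Semantics

/-! ### The rewriting -/

section Rewriting

variable {σ ρ ν : Type*}

/-- The atom `p(v₁, …, v_k)` with variables as arguments. -/
def varAtom (p : ρ) (vs : List ν) : Atom ρ (Term σ ν) := ⟨p, vs.map Term.var⟩

/-- The positive body literal `p(v₁, …, v_k)`. -/
def posLit (p : ρ) (vs : List ν) : Lit σ ρ ν := .basic ⟨false, .atom (varAtom p vs)⟩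

/-- `F(X₁, Z, Z'), …, F(X_b, Z, Z')`. -/
def nameLits {b : ℕ} (F : ρ) (X : Fin b → ν) (Z Z' : List ν) : List (Lit σ ρ ν) :=
  (List.finRange b).map fun i => posLit F (X i :: (Z ++ Z'))

/-- The list of all `X_i ≠ X_j` with `i < j`. -/
def distinctLits {b : ℕ} (X : Fin b → ν) : List (Lit σ ρ ν) :=
  (List.finRange b).flatMap fun i =>
    ((List.finRange b).filter fun j => i < j).map fun j =>
      .basic ⟨false, .cmp .ne (.var (X i)) (.var (X j))⟩

/-- `b ≤ #count{Y : F(Y, Z, Z')}`. -/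
def countLit (b : ℕ) (F : ρ) (Y : ν) (Z Z' : List ν) : Lit σ ρ ν :=
  .count false
    { left := some (.int b, .le)
      elems := [⟨[.var Y], [⟨false, .atom (varAtom F (Y :: (Z ++ Z')))⟩]⟩]
      right := none }

/-- `F'(Z) ← F(Y, Z, Z')`. -/
def projRule (F F' : ρ) (Y : ν) (Z Z' : List ν) :
    Rule ρ (Term σ ν) (List (Elem ρ (Term σ ν))) :=
  ⟨some ⟨false, varAtom F' Z⟩, [posLit F (Y :: (Z ++ Z'))]⟩

/-- The program obtained from `P` by replacing the rule `r` with the rules in `S`. -/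
def replace (P : Program σ ρ ν) (r : Rule ρ (Term σ ν) (List (Elem ρ (Term σ ν))))
    (S : Program σ ρ ν) : Program σ ρ ν :=
  (P \ {r}) ∪ S

/-- The ground atoms with predicate symbol `p/k`. -/
def atomsOf (p : ρ) (k : ℕ) : Set (GAtom σ ρ) := {a | a.pred = p ∧ a.args.length = k}

end Rewriting

end ASP

/-! Both semantics are brought to one form. `Respects sem P I K` is a family of implications imposed
on `K`, and `I` is an answer set iff `K = I` satisfies them and no proper subset `K` of `I` does
(`mem_answerSets_iff`). So it suffices to compare `Respects` for `K ⊆ I`. There a positive atom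
holds iff it lies in `K`, and the count literal holds iff `b` distinct witnesses have their `F`-atom
in `K` (`countLit_holds`), because a lower bound on a count of positive atoms is monotone. As no `X
i` occurs in `H` or `G`, the equivalence of `∀ x, A x ∧ C → B` with `(∃ x, A x) ∧ C → B` turns one
rule into the other (`respectedBy_nameLits_iff_countLit`). The Herbrand universe stays the same
(`herbrand_replace`).

If `Z` is nonempty, its variables must remain global instead of becoming local to the aggregate
element; the literal `F'(Z)` ensures this. Adjoining it to `G`, the same equivalence identifies the
answer sets of `P'` and `P''`. In `P'` the literal is redundant, since `F(X₁, Z, Z')` and the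
projection rule yield it (`respectedBy_append_posLit_iff`). What remains is that an explicit
definition of a fresh predicate extends every answer set in exactly one way
(`bijOn_diff_of_definition`). -/

namespace ASP

/-! ### Substitution and instantiation depend only on the variables that occur. -/

section Congruence

variable {σ ρ ν : Type*}

theorem Term.subst_congr {θ η : ν → GTerm σ} :
    ∀ {t : Term σ ν}, (∀ v ∈ t.vars, θ v = η v) → t.subst θ = t.subst η
  | .var v, h => h v rfl
  | .int _, _ => rfl
  | .app f ts, h => by
    simp only [Term.subst]
    congr
    funext i
    exact Term.subst_congr fun v hv => h v (Set.mem_iUnion.2 ⟨i, hv⟩)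

theorem mem_varsOf {T : Set (Term σ ν)} {v : ν} : v ∈ varsOf T ↔ ∃ t ∈ T, v ∈ t.vars := by
  simp [varsOf]

theorem varsOf_mono {S T : Set (Term σ ν)} (h : S ⊆ T) : varsOf S ⊆ varsOf T :=
  Set.biUnion_subset_biUnion_left h

theorem subst_congr_of_mem {T : Set (Term σ ν)} {θ η : ν → GTerm σ}
    (h : ∀ v ∈ varsOf T, θ v = η v) {t : Term σ ν} (ht : t ∈ T) : t.subst θ = t.subst η :=
  Term.subst_congr fun v hv => h v (mem_varsOf.2 ⟨t, ht, hv⟩)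

theorem Atom.subst_congr {a : Atom ρ (Term σ ν)} {θ η : ν → GTerm σ}
    (h : ∀ v ∈ varsOf {t | t ∈ a.args}, θ v = η v) : a.subst θ = a.subst η := by
  simp only [Atom.subst]
  congr 1
  exact List.map_congr_left fun t ht => subst_congr_of_mem h ht

theorem BasicLit.subst_congr {l : BasicLit ρ (Term σ ν)} {θ η : ν → GTerm σ}
    (h : ∀ v ∈ varsOf l.atom.terms, θ v = η v) : l.subst θ = l.subst η := by
  obtain ⟨neg, a | ⟨rel, s, t⟩⟩ := l
  · simp only [BasicLit.subst, BasicAtom.subst]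
    rw [Atom.subst_congr h]
  · have hs : s.subst θ = s.subst η := subst_congr_of_mem h (Or.inl rfl)
    have ht : t.subst θ = t.subst η := subst_congr_of_mem h (Or.inr rfl)
    simp only [BasicLit.subst, BasicAtom.subst, hs, ht]

theorem Elem.subst_congr {e : Elem ρ (Term σ ν)} {θ η : ν → GTerm σ}
    (h : ∀ v ∈ varsOf e.terms, θ v = η v) : e.subst θ = e.subst η := by
  simp only [Elem.subst]
  congr 1
  · exact List.map_congr_left fun t ht => subst_congr_of_mem h (Or.inl ht)
  · exact List.map_congr_left fun l hl => BasicLit.subst_congr fun v hv =>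
      h v (varsOf_mono (T := e.terms) (fun t ht => Or.inr ⟨l, hl, ht⟩) hv)

theorem head_subst_congr {H : Option (HeadLit ρ (Term σ ν))} {θ η : ν → GTerm σ}
    (h : ∀ v ∈ headVars H, θ v = η v) : H.map (HeadLit.subst θ) = H.map (HeadLit.subst η) := by
  obtain _ | ⟨neg, a⟩ := H
  · rfl
  · have : a.subst θ = a.subst η := Atom.subst_congr fun v hv =>
      h v (varsOf_mono (T := headTerms _) (fun t ht => ⟨⟨neg, a⟩, rfl, ht⟩) hv)
    simp [HeadLit.subst, this]

theorem Literal.globalVars_subset_vars (l : Lit σ ρ ν) : l.globalVars ⊆ l.vars := by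
  obtain l | ⟨neg, c⟩ := l
  · exact subset_rfl
  · exact varsOf_mono Set.subset_union_left

/-- Instantiation of a literal does not depend on the treatment of variables that do not occur
in it. -/
theorem Literal.inst_congr {U : Set (GTerm σ)} {gv gv' : Set ν} {θ θ' : ν → GTerm σ}
    {l : Lit σ ρ ν} (hsub : gv ⊆ gv') (hθ : ∀ v ∈ gv, θ' v = θ v)
    (hl : l.globalVars ⊆ gv) (hdiff : ∀ v ∈ gv', v ∉ gv → v ∉ l.vars) (hU : ∀ v, θ' v ∈ U) :
    l.inst U gv' θ' = l.inst U gv θ := by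
  classical
  obtain l | ⟨neg, c⟩ := l
  · simp only [Literal.inst]
    rw [BasicLit.subst_congr fun v hv => hθ v (hl hv)]
  · obtain ⟨left, elems, right⟩ := c
    have key : ∀ t ∈ Count.guardTerms ⟨left, elems, right⟩, t.subst θ' = t.subst θ :=
      fun t ht => subst_congr_of_mem (fun v hv => hθ v (hl hv)) ht
    simp only [Literal.inst, Count.inst]
    congr 2
    · cases left with
      | none => rfl
      | some g => simp [key g.1 (Or.inl ⟨g, rfl, rfl⟩)]
    · ext e'
      constructor
      · rintro ⟨e, he, η, hη, hηθ, rfl⟩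
        exact ⟨e, he, η, hη, fun v hv => (hηθ v (hsub hv)).trans (hθ v hv), rfl⟩
      · rintro ⟨e, he, η, hη, hηθ, rfl⟩
        -- Overriding `η` by `θ'` on `gv'` makes it admissible for the larger set of global
        -- variables; on `gv` the two agree, and the variables of `gv'` outside `gv` do not occur in
        -- the element.
        refine ⟨e, he, fun v => if v ∈ gv' then θ' v else η v, fun v => ?_, fun v hv => if_pos hv,
          Elem.subst_congr fun v hv => ?_⟩
        · beta_reduce
          split_ifs
          exacts [hU v, hη v]
        · split_ifs with hv'
          · by_cases hg : v ∈ gv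
            · rw [hηθ v hg, hθ v hg]
            · exact absurd (varsOf_mono (fun t ht => Or.inr ⟨e, he, ht⟩) hv) (hdiff v hv' hg)
          · rfl
    · cases right with
      | none => rfl
      | some g => simp [key g.2 (Or.inr ⟨g, rfl, rfl⟩)]

theorem herbrand_congr {P Q : Program σ ρ ν} (h : functors P = functors Q) :
    herbrand P = herbrand Q := by
  have : ∀ {P Q : Program σ ρ ν}, functors P = functors Q →
      ∀ t, InHerbrand P t → InHerbrand Q t := by
    intro P Q h t ht
    induction ht with
    | int n => exact .int n
    | app f ts hf _ ih => exact .app f ts (h ▸ hf) ih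
  exact Set.ext fun t => ⟨this h t, this h.symm t⟩

theorem HeadLit.redSat_self {I : Set (GAtom σ ρ)} {h : HeadLit ρ (GTerm σ)} :
    h.RedSat I I ↔ h.Sat I := by
  obtain ⟨_ | _, a⟩ := h <;> simp [HeadLit.RedSat, HeadLit.Sat]

end Congruence

/-! ### A uniform form of the two reducts, and the meaning of the special literals. -/

section Clauses

variable {σ ρ ν : Type*} [LT σ]

/-- `K` satisfies the reduct of the literal with respect to `I`; under ASP-Core-2, where literals
are not reduced, the literal is true both in `I` and in `K`. -/
def Literal.Holds (sem : Semantics) (I K : Set (GAtom σ ρ)) (l : GLit σ ρ) : Prop :=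
  match sem with
  | .aspCore2 => l.Sat I ∧ l.Sat K
  | .gringo => l.RedSat I K

def HeadLit.Holds (sem : Semantics) (I K : Set (GAtom σ ρ)) (h : HeadLit ρ (GTerm σ)) : Prop :=
  match sem with
  | .aspCore2 => h.Sat K
  | .gringo => h.RedSat I K

/-- The implication that a ground rule imposes on `K` in the reduct with respect to `I`. -/
def Rule.Respects (sem : Semantics) (I K : Set (GAtom σ ρ)) (r : GRule σ ρ) : Prop :=
  (∀ l ∈ r.body, l.Holds sem I K) → ∃ h ∈ r.head, h.Holds sem I K

def Respects (sem : Semantics) (P : Program σ ρ ν) (I K : Set (GAtom σ ρ)) : Prop :=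
  ∀ r ∈ ground P, r.Respects sem I K

theorem BasicLit.redSat_self {I : Set (GAtom σ ρ)} {l : BasicLit ρ (GTerm σ)} :
    l.RedSat I I ↔ l.Sat I := by
  obtain ⟨_ | _, a⟩ := l <;> simp [BasicLit.RedSat, BasicLit.Sat]

theorem Literal.redSat_self {I : Set (GAtom σ ρ)} {l : GLit σ ρ} : l.RedSat I I ↔ l.Sat I := by
  obtain l | ⟨_ | _, c⟩ := l
  · exact BasicLit.redSat_self
  · simp [Literal.RedSat, Literal.Sat, Count.RedSat, BasicLit.redSat_self, Count.Sat]
  · rfl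

/-- Under ASP-Core-2, truth of the body in `I` merely moves from the selection of rules into
`Literal.Holds`. The gringo reduct also demands that `I` satisfy every ground rule; this is `hI`,
because reducing with `K = I` amounts to evaluation in `I`. -/
theorem reductModel_iff {sem : Semantics} {P : Program σ ρ ν} {I K : Set (GAtom σ ρ)}
    (hI : Respects sem P I I) : ReductModel sem (ground P) I K ↔ Respects sem P I K := by
  cases sem
  · simp only [ReductModel, flpReduct, Respects, Rule.Respects, Literal.Holds, HeadLit.Holds,
      Rule.Sat, Rule.BodySat, Rule.HeadSat, Set.mem_ofPred_eq]
    exact ⟨fun h r hr hb => h r ⟨hr, fun l hl => (hb l hl).1⟩ fun l hl => (hb l hl).2,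
      fun h r hr hb => h r hr.1 fun l hl => ⟨hr.2 l hl, hb l hl⟩⟩
  · simp only [Respects, Rule.Respects, Literal.Holds, HeadLit.Holds, Literal.redSat_self,
      HeadLit.redSat_self] at hI
    exact ⟨fun h r hr => (h r hr).2, fun h r hr => ⟨hI r hr, h r hr⟩⟩

theorem respects_self_of_reductModel {sem : Semantics} {P : Program σ ρ ν}
    {I : Set (GAtom σ ρ)} (h : ReductModel sem (ground P) I I) : Respects sem P I I := by
  cases sem
  · exact fun r hr hb => h r ⟨hr, fun l hl => (hb l hl).1⟩ fun l hl => (hb l hl).2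
  · exact fun r hr => (h r hr).2

theorem mem_answerSets_iff {sem : Semantics} {P : Program σ ρ ν} {I : Set (GAtom σ ρ)} :
    I ∈ answerSets sem P ↔
      Respects sem P I I ∧ ∀ K ⊆ I, Respects sem P I K → I ⊆ K := by
  constructor
  · intro h
    have hI := respects_self_of_reductModel h.1
    exact ⟨hI, fun K hK hr => h.2 ((reductModel_iff hI).2 hr) hK⟩
  · rintro ⟨hI, h⟩
    exact ⟨(reductModel_iff hI).2 hI, fun K hr hK => h K hK ((reductModel_iff hI).1 hr)⟩

theorem respects_iff {sem : Semantics} {P : Program σ ρ ν} {I K : Set (GAtom σ ρ)} :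
    Respects sem P I K ↔ ∀ r ∈ P, ∀ θ : ν → GTerm σ, (∀ v, θ v ∈ herbrand P) →
      (r.inst (herbrand P) θ).Respects sem I K := by
  constructor
  · exact fun h r hr θ hθ => h _ ⟨r, hr, θ, hθ, rfl⟩
  · rintro h _ ⟨r, hr, θ, hθ, rfl⟩
    exact h r hr θ hθ

theorem Rule.inst_respects {sem : Semantics} {U : Set (GTerm σ)} {θ : ν → GTerm σ}
    {I K : Set (GAtom σ ρ)} {r : Rule ρ (Term σ ν) (List (Elem ρ (Term σ ν)))} :
    (r.inst U θ).Respects sem I K ↔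
      ((∀ l ∈ r.body, (l.inst U r.globalVars θ).Holds sem I K) →
        ∃ h ∈ r.head.map (HeadLit.subst θ), h.Holds sem I K) := by
  simp [Rule.Respects, Rule.inst]

theorem posLit_holds {sem : Semantics} {U : Set (GTerm σ)} {gv : Set ν} {θ : ν → GTerm σ}
    {I K : Set (GAtom σ ρ)} (hK : K ⊆ I) {p : ρ} {vs : List ν} :
    ((posLit p vs : Lit σ ρ ν).inst U gv θ).Holds sem I K ↔ (⟨p, vs.map θ⟩ : GAtom σ ρ) ∈ K := by
  have : (varAtom p vs : Atom ρ (Term σ ν)).subst θ = ⟨p, vs.map θ⟩ := by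
    simp [varAtom, Atom.subst, Function.comp_def, Term.subst]
  cases sem <;>
    simp [posLit, Literal.inst, Literal.Holds, Literal.Sat, Literal.RedSat, BasicLit.RedSat,
      BasicLit.Sat, BasicLit.subst, BasicAtom.subst, BasicAtom.Sat, this] <;>
    exact fun h => hK h

theorem distinctLits_hold {sem : Semantics} {U : Set (GTerm σ)} {gv : Set ν} {θ : ν → GTerm σ}
    {I K : Set (GAtom σ ρ)} {b : ℕ} {X : Fin b → ν} :
    (∀ l ∈ (distinctLits X : List (Lit σ ρ ν)), (l.inst U gv θ).Holds sem I K) ↔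
      Function.Injective (θ ∘ X) := by
  have : (∀ l ∈ (distinctLits X : List (Lit σ ρ ν)), (l.inst U gv θ).Holds sem I K) ↔
      ∀ i j, i < j → θ (X i) ≠ θ (X j) := by
    have hcmp : ∀ i j, Literal.Holds sem I K (Literal.inst U gv θ
        (.basic ⟨false, .cmp .ne (.var (X i)) (.var (X j))⟩ : Lit σ ρ ν)) ↔
          θ (X i) ≠ θ (X j) := by
      intro i j
      cases sem
      · exact and_self_iff
      · exact ⟨fun h => h.1, fun h => ⟨h, fun _ => h⟩⟩
    simp only [distinctLits, List.mem_flatMap, List.mem_map, List.mem_filter, List.mem_finRange,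
      true_and, decide_eq_true_eq]
    constructor
    · exact fun h i j hij => (hcmp i j).1 (h _ ⟨i, j, hij, rfl⟩)
    · rintro h _ ⟨i, j, hij, rfl⟩
      exact (hcmp i j).2 (h i j hij)
  rw [this]
  constructor
  · intro h i j hij
    by_contra hne
    rcases lt_or_gt_of_ne hne with hlt | hlt
    exacts [h i j hlt hij, h j i hlt hij.symm]
  · exact fun h i j hij heq => hij.ne (h heq)

/-- Both sides say `b ≤ T.encard`. For finite `T` the term order on integers is the usual one; for
infinite `T` the value `⊤` exceeds every term. -/
theorem le_countValue_iff {b : ℕ} {T : Set (List (GTerm σ))} :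
    Rel.le.Holds ((Term.int b : GTerm σ) : WithTop (GTerm σ)) (countValue T) ↔
      ∃ x : Fin b → List (GTerm σ), Function.Injective x ∧ ∀ i, x i ∈ T := by
  have hemb : (∃ x : Fin b → List (GTerm σ), Function.Injective x ∧ ∀ i, x i ∈ T) ↔
      (b : ℕ∞) ≤ T.encard := by
    constructor
    · rintro ⟨x, hx, hT⟩
      calc (b : ℕ∞) = (Set.range x).encard := by
            rw [← Set.image_univ, hx.encard_image, Set.encard_univ]; simp
        _ ≤ T.encard := Set.encard_le_encard (Set.range_subset_iff.2 hT)
    · intro h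
      obtain ⟨S, hST, hS⟩ := Set.exists_subset_encard_eq h
      have hfin : S.Finite := Set.finite_of_encard_eq_coe hS
      have hcard : hfin.toFinset.card = b := by
        rw [hfin.encard_eq_coe_toFinset_card] at hS
        exact_mod_cast hS
      let e := (hfin.toFinset.equivFinOfCardEq hcard).symm
      exact ⟨fun i => e i, Subtype.val_injective.comp e.injective,
        fun i => hST (hfin.mem_toFinset.1 (e i).2)⟩
  rw [hemb]
  by_cases hT : T.Finite
  · rw [countValue, if_pos hT, ← hT.cast_ncard_eq]
    have hlt : ∀ m n : ℤ, (Term.int m : GTerm σ) < Term.int n ↔ m < n := fun m n =>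
      ⟨fun h => by cases h; assumption, fun h => Term.Less.int h⟩
    simp only [Rel.Holds, WithTop.coe_lt_coe, WithTop.coe_inj, hlt, Term.int.injEq, Nat.cast_lt,
      Nat.cast_inj, Nat.cast_le]
    exact le_iff_lt_or_eq.symm
  · rw [countValue, if_neg hT, Set.Infinite.encard_eq hT]
    simp [Rel.Holds, WithTop.coe_lt_top]

/-- Since `Y ∉ gv`, the counted variable is local and ranges over `U`, while `Z` and `Z'` are global
and fixed by `θ`. Witnesses in `K` are also witnesses in `I`, so the evaluation in `I` required by
either semantics adds nothing. -/
theorem countLit_holds {sem : Semantics} {U : Set (GTerm σ)} {gv : Set ν} {θ : ν → GTerm σ}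
    {I K : Set (GAtom σ ρ)} (hK : K ⊆ I) {b : ℕ} {F : ρ} {Y : ν} {Z Z' : List ν}
    (hθ : ∀ v, θ v ∈ U) (hY : Y ∉ gv) (hZ : ∀ v, v ∈ Z ∨ v ∈ Z' → v ∈ gv) :
    ((countLit b F Y Z Z' : Lit σ ρ ν).inst U gv θ).Holds sem I K ↔
      ∃ x : Fin b → GTerm σ, Function.Injective x ∧
        ∀ i, x i ∈ U ∧ (⟨F, x i :: (Z ++ Z').map θ⟩ : GAtom σ ρ) ∈ K := by
  classical
  let T : Set (GAtom σ ρ) → Set (List (GTerm σ)) := fun J =>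
    {t | ∃ u, u ∈ U ∧ (⟨F, u :: (Z ++ Z').map θ⟩ : GAtom σ ρ) ∈ J ∧ [u] = t}
  let elem : Elem ρ (Term σ ν) := ⟨[.var Y], [⟨false, .atom (varAtom F (Y :: (Z ++ Z')))⟩]⟩
  have hsub : ∀ η : ν → GTerm σ, (∀ v ∈ gv, η v = θ v) →
      elem.subst η = ⟨[η Y], [⟨false, .atom ⟨F, η Y :: (Z ++ Z').map θ⟩⟩]⟩ := by
    intro η hη
    have : (Z ++ Z').map η = (Z ++ Z').map θ :=
      List.map_congr_left fun v hv => hη v (hZ v (List.mem_append.1 hv))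
    rw [← this]
    simp [elem, Elem.subst, Term.subst, BasicLit.subst, BasicAtom.subst, Atom.subst, varAtom,
      Function.comp_def]
  -- The predicate `R` is kept general because it is used both for truth in `J` and, with `J = K`,
  -- for the reduced conditions of gringo.
  have hT : ∀ R : BasicLit ρ (GTerm σ) → Prop, ∀ J : Set (GAtom σ ρ),
      (∀ a, R ⟨false, .atom a⟩ ↔ a ∈ J) →
      {t | ∃ e ∈ {e' | ∃ e ∈ [elem], ∃ η : ν → GTerm σ,
        (∀ v, η v ∈ U) ∧ (∀ v ∈ gv, η v = θ v) ∧ e' = e.subst η},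
          e.tuple = t ∧ ∀ l ∈ e.cond, R l} = T J := by
    intro R J hR
    ext t
    constructor
    · rintro ⟨_, ⟨e, he, η, hη, hηθ, rfl⟩, rfl, hc⟩
      obtain rfl := List.mem_singleton.1 he
      rw [hsub η hηθ] at hc ⊢
      exact ⟨η Y, hη Y, (hR _).1 (hc _ (List.mem_singleton.2 rfl)), rfl⟩
    · rintro ⟨u, hu, hJ, rfl⟩
      have hη : ∀ v ∈ gv, Function.update θ Y u v = θ v := fun v hv =>
        Function.update_of_ne (by rintro rfl; exact hY hv) _ _
      refine ⟨elem.subst (Function.update θ Y u),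
        ⟨elem, List.mem_singleton.2 rfl, _, fun v => ?_, hη, rfl⟩, ?_⟩
      · by_cases hv : v = Y
        · subst hv; simpa using hu
        · simpa [hv] using hθ v
      · rw [hsub _ hη]
        simpa [hR] using hJ
  have hsat : ∀ J : Set (GAtom σ ρ), (∃ x : Fin b → List (GTerm σ), Function.Injective x ∧
      ∀ i, x i ∈ T J) ↔ ∃ x : Fin b → GTerm σ, Function.Injective x ∧
        ∀ i, x i ∈ U ∧ (⟨F, x i :: (Z ++ Z').map θ⟩ : GAtom σ ρ) ∈ J := by
    intro J
    constructor
    · rintro ⟨x, hx, h⟩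
      choose u hu hJ hux using h
      refine ⟨u, fun i j hij => hx ?_, fun i => ⟨hu i, hJ i⟩⟩
      rw [← hux i, ← hux j, hij]
    · rintro ⟨u, hu, h⟩
      exact ⟨fun i => [u i], fun i j hij => hu (List.singleton_injective hij),
        fun i => ⟨u i, (h i).1, (h i).2, rfl⟩⟩
  have hguard : ∀ E J, Count.GuardsHold
      (⟨some ((Term.int b : GTerm σ), .le), E, none⟩ : GCount σ ρ) (T J) ↔
      ∃ x : Fin b → GTerm σ, Function.Injective x ∧
        ∀ i, x i ∈ U ∧ (⟨F, x i :: (Z ++ Z').map θ⟩ : GAtom σ ρ) ∈ J := by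
    intro E J
    rw [← hsat, ← le_countValue_iff]
    simp [Count.GuardsHold]
  have hmono : (∃ x : Fin b → GTerm σ, Function.Injective x ∧
        ∀ i, x i ∈ U ∧ (⟨F, x i :: (Z ++ Z').map θ⟩ : GAtom σ ρ) ∈ K) →
      ∃ x : Fin b → GTerm σ, Function.Injective x ∧
        ∀ i, x i ∈ U ∧ (⟨F, x i :: (Z ++ Z').map θ⟩ : GAtom σ ρ) ∈ I :=
    fun ⟨x, hx, h⟩ => ⟨x, hx, fun i => ⟨(h i).1, hK (h i).2⟩⟩
  have hS : ∀ J : Set (GAtom σ ρ), Literal.Sat J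
      ((countLit b F Y Z Z' : Lit σ ρ ν).inst U gv θ) ↔ ∃ x : Fin b → GTerm σ,
        Function.Injective x ∧ ∀ i, x i ∈ U ∧ (⟨F, x i :: (Z ++ Z').map θ⟩ : GAtom σ ρ) ∈ J := by
    intro J
    rw [← hguard _ J, ← hT (BasicLit.Sat J) J fun a => Iff.rfl]
    rfl
  cases sem
  · simp only [Literal.Holds, hS]
    exact ⟨fun h => h.2, fun h => ⟨hmono h, h⟩⟩
  · have : Literal.RedSat I K ((countLit b F Y Z Z' : Lit σ ρ ν).inst U gv θ) ↔
        Literal.Sat I ((countLit b F Y Z Z' : Lit σ ρ ν).inst U gv θ) ∧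
          ∃ x : Fin b → GTerm σ, Function.Injective x ∧
            ∀ i, x i ∈ U ∧ (⟨F, x i :: (Z ++ Z').map θ⟩ : GAtom σ ρ) ∈ K := by
      rw [← hguard _ K, ← hT (BasicLit.RedSat I K) K fun a =>
        ⟨fun h => h.2 rfl, fun h => ⟨hK h, fun _ => h⟩⟩]
      rfl
    simp only [Literal.Holds, this, hS]
    exact ⟨fun h => h.2, fun h => ⟨hmono h, h⟩⟩

end Clauses

end ASP

namespace ASP

/-! ### Replacing a rule: the Herbrand universe, global variables, and witnesses versus counting. -/

section Replacement

variable {σ ρ ν : Type*}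

def Literal.functors (l : Lit σ ρ ν) : Set (σ × ℕ) := ⋃ t ∈ l.terms, t.functors

def Rule.functors (r : Rule ρ (Term σ ν) (List (Elem ρ (Term σ ν)))) : Set (σ × ℕ) :=
  ⋃ t ∈ r.terms, t.functors

theorem Rule.mem_functors {r : Rule ρ (Term σ ν) (List (Elem ρ (Term σ ν)))} {x : σ × ℕ} :
    x ∈ r.functors ↔
      (∃ t ∈ headTerms r.head, x ∈ t.functors) ∨ ∃ l ∈ r.body, x ∈ l.functors := by
  simp only [Rule.functors, Literal.functors, Rule.terms, Set.mem_iUnion, Set.mem_union,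
    Set.mem_ofPred_eq, exists_prop]
  constructor
  · rintro ⟨t, ht | ⟨l, hl, ht⟩, hx⟩
    exacts [.inl ⟨t, ht, hx⟩, .inr ⟨l, hl, t, ht, hx⟩]
  · rintro (⟨t, ht, hx⟩ | ⟨l, hl, t, ht, hx⟩)
    exacts [⟨t, .inl ht, hx⟩, ⟨t, .inr ⟨l, hl, ht⟩, hx⟩]

theorem notMem_functors_posLit {p : ρ} {vs : List ν} {x : σ × ℕ} :
    x ∉ (posLit p vs : Lit σ ρ ν).functors := by
  simp [Literal.functors, Literal.terms, posLit, BasicAtom.terms, varAtom, Term.functors]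

theorem notMem_functors_nameLits {b : ℕ} {F : ρ} {X : Fin b → ν} {Z Z' : List ν} {x : σ × ℕ}
    {l : Lit σ ρ ν} (hl : l ∈ nameLits F X Z Z') : x ∉ l.functors := by
  obtain ⟨i, -, rfl⟩ := List.mem_map.1 hl
  exact notMem_functors_posLit

theorem notMem_functors_distinctLits {b : ℕ} {X : Fin b → ν} {x : σ × ℕ}
    {l : Lit σ ρ ν} (hl : l ∈ distinctLits X) : x ∉ l.functors := by
  simp only [distinctLits, List.mem_flatMap, List.mem_map] at hl
  obtain ⟨i, -, j, -, rfl⟩ := hl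
  simp [Literal.functors, Literal.terms, BasicAtom.terms, Term.functors]

/-- The only nonvariable term is the guard `b`, an integer, and integers belong to every Herbrand
universe without being function symbols. -/
theorem notMem_functors_countLit {b : ℕ} {F : ρ} {Y : ν} {Z Z' : List ν} {x : σ × ℕ} :
    x ∉ (countLit b F Y Z Z' : Lit σ ρ ν).functors := by
  simp only [Literal.functors, Literal.terms, countLit, Count.guardTerms, Elem.terms,
    BasicAtom.terms, varAtom, Set.mem_iUnion, not_exists]
  rintro t ((⟨g, hg, rfl⟩ | ⟨g, hg, rfl⟩) | ⟨e, he, ht⟩)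
  · cases hg
    exact id
  · cases hg
  · obtain rfl := List.mem_singleton.1 he
    rcases ht with ht | ⟨l, hl, ht⟩
    · obtain rfl := List.mem_singleton.1 ht
      exact id
    · obtain rfl := List.mem_singleton.1 hl
      obtain ⟨v, -, rfl⟩ := List.mem_map.1 ht
      exact id

theorem notMem_functors_projRule {F F' : ρ} {Y : ν} {Z Z' : List ν} {x : σ × ℕ} :
    x ∉ (projRule F F' Y Z Z' : Rule ρ (Term σ ν) _).functors := by
  rw [Rule.mem_functors]
  rintro (⟨t, ⟨h, hh, ht⟩, hx⟩ | ⟨l, hl, hx⟩)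
  · cases hh
    obtain ⟨v, -, rfl⟩ := List.mem_map.1 ht
    exact hx
  · obtain rfl := List.mem_singleton.1 hl
    exact notMem_functors_posLit hx

theorem herbrand_replace {P S : Program σ ρ ν}
    {r : Rule ρ (Term σ ν) (List (Elem ρ (Term σ ν)))} (hr : r ∈ P)
    (h : ∀ x, (∃ s ∈ S, x ∈ s.functors) ↔ x ∈ r.functors) :
    herbrand (replace P r S) = herbrand P := by
  have hf : ∀ (Q : Program σ ρ ν) x, x ∈ ASP.functors Q ↔ ∃ s ∈ Q, x ∈ s.functors := by
    intro Q x
    simp only [ASP.functors, Set.mem_iUnion, Rule.functors, exists_prop]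
  refine herbrand_congr (Set.ext fun x => ?_)
  rw [hf, hf]
  constructor
  · rintro ⟨s, hs | hs, hx⟩
    exacts [⟨s, hs.1, hx⟩, ⟨r, hr, (h x).1 ⟨s, hs, hx⟩⟩]
  · rintro ⟨s, hs, hx⟩
    by_cases hsr : s = r
    · obtain ⟨s', hs', hx'⟩ := (h x).2 (hsr ▸ hx)
      exact ⟨s', .inr hs', hx'⟩
    · exact ⟨s, .inl ⟨hs, hsr⟩, hx⟩

theorem mem_globalVars_posLit {p : ρ} {vs : List ν} {v : ν} :
    v ∈ (posLit p vs : Lit σ ρ ν).globalVars ↔ v ∈ vs := by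
  simp [Literal.globalVars, mem_varsOf, Literal.outerTerms, posLit, BasicAtom.terms, varAtom,
    Term.vars]

theorem globalVars_countLit {b : ℕ} {F : ρ} {Y : ν} {Z Z' : List ν} :
    (countLit b F Y Z Z' : Lit σ ρ ν).globalVars = ∅ := by
  ext v
  simp [Literal.globalVars, mem_varsOf, Literal.outerTerms, countLit, Count.guardTerms, Term.vars]

theorem mem_globalVars_nameLits {b : ℕ} {F : ρ} {X : Fin b → ν} {Z Z' : List ν} {v : ν}
    {l : Lit σ ρ ν} (hl : l ∈ nameLits F X Z Z') (hv : v ∈ l.globalVars) :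
    v ∈ Set.range X ∨ v ∈ Z ∨ v ∈ Z' := by
  obtain ⟨i, -, rfl⟩ := List.mem_map.1 hl
  rw [mem_globalVars_posLit] at hv
  simp only [List.mem_cons, List.mem_append] at hv
  exact hv.imp_left fun h => ⟨i, h.symm⟩

theorem mem_globalVars_distinctLits {b : ℕ} {X : Fin b → ν} {v : ν}
    {l : Lit σ ρ ν} (hl : l ∈ distinctLits X) (hv : v ∈ l.globalVars) : v ∈ Set.range X := by
  simp only [distinctLits, List.mem_flatMap, List.mem_map] at hl
  obtain ⟨i, -, j, -, rfl⟩ := hl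
  simp only [Literal.globalVars, mem_varsOf, Literal.outerTerms, BasicAtom.terms] at hv
  obtain ⟨t, rfl | rfl, hv⟩ := hv
  exacts [⟨i, hv.symm⟩, ⟨j, hv.symm⟩]

variable [LT σ]

/-- `K` respects all instances of the rule over the universe `U`. -/
def Rule.RespectedBy (sem : Semantics) (U : Set (GTerm σ)) (I K : Set (GAtom σ ρ))
    (r : Rule ρ (Term σ ν) (List (Elem ρ (Term σ ν)))) : Prop :=
  ∀ θ : ν → GTerm σ, (∀ v, θ v ∈ U) → (r.inst U θ).Respects sem I K

theorem respects_replace_iff {sem : Semantics} {P S : Program σ ρ ν} {I K : Set (GAtom σ ρ)}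
    {r : Rule ρ (Term σ ν) (List (Elem ρ (Term σ ν)))}
    (hU : herbrand (replace P r S) = herbrand P) :
    Respects sem (replace P r S) I K ↔
      (∀ s ∈ P, s ≠ r → s.RespectedBy sem (herbrand P) I K) ∧
        ∀ s ∈ S, s.RespectedBy sem (herbrand P) I K := by
  rw [respects_iff, hU]
  constructor
  · exact fun h => ⟨fun s hs hsr => h s (.inl ⟨hs, hsr⟩), fun s hs => h s (.inr hs)⟩
  · rintro ⟨h₁, h₂⟩ s (hs | hs)
    exacts [h₁ s hs.1 hs.2, h₂ s hs]

theorem respects_iff_of_mem {sem : Semantics} {P : Program σ ρ ν} {I K : Set (GAtom σ ρ)}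
    {r : Rule ρ (Term σ ν) (List (Elem ρ (Term σ ν)))} (hr : r ∈ P) :
    Respects sem P I K ↔ (∀ s ∈ P, s ≠ r → s.RespectedBy sem (herbrand P) I K) ∧
      r.RespectedBy sem (herbrand P) I K := by
  rw [respects_iff]
  constructor
  · exact fun h => ⟨fun s hs _ => h s hs, h r hr⟩
  · rintro ⟨h₁, h₂⟩ s hs
    by_cases hsr : s = r
    exacts [hsr ▸ h₂, h₁ s hs hsr]

theorem answerSets_congr {sem : Semantics} {P Q : Program σ ρ ν}
    (h : ∀ I K : Set (GAtom σ ρ), K ⊆ I → (Respects sem P I K ↔ Respects sem Q I K)) :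
    answerSets sem P = answerSets sem Q := by
  ext I
  rw [mem_answerSets_iff, mem_answerSets_iff, h I I subset_rfl]
  exact and_congr_right fun _ => forall₂_congr fun K hK => by rw [h I K hK]

theorem nameLits_hold {sem : Semantics} {U : Set (GTerm σ)} {gv : Set ν} {θ : ν → GTerm σ}
    {I K : Set (GAtom σ ρ)} (hK : K ⊆ I) {b : ℕ} {F : ρ} {X : Fin b → ν} {Z Z' : List ν} :
    (∀ l ∈ (nameLits F X Z Z' : List (Lit σ ρ ν)), (l.inst U gv θ).Holds sem I K) ↔
      ∀ i, (⟨F, θ (X i) :: (Z ++ Z').map θ⟩ : GAtom σ ρ) ∈ K := by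
  simp only [nameLits, List.forall_mem_map, List.mem_finRange, true_implies, posLit_holds hK,
    List.map_cons]

/-- Requiring `b` distinct witnesses and counting at least `b` of them impose the same condition
on the subsets of `I`. -/
theorem respectedBy_nameLits_iff_countLit {sem : Semantics} {U : Set (GTerm σ)}
    {I K : Set (GAtom σ ρ)} (hK : K ⊆ I) {b : ℕ} {H : Option (HeadLit ρ (Term σ ν))} {F : ρ}
    {X : Fin b → ν} {Z Z' : List ν} {G G' : List (Lit σ ρ ν)} {Y : ν}
    (hX : Function.Injective X) (hGG' : ∀ l, l ∈ G ↔ l ∈ G')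
    (hZ : ∀ v, v ∈ Z ∨ v ∈ Z' → ∃ l ∈ G', v ∈ l.globalVars)
    (hXH : ∀ i, X i ∉ headVars H) (hXG : ∀ i, ∀ l ∈ G', X i ∉ l.vars)
    (hYH : Y ∉ headVars H) (hYG : ∀ l ∈ G', Y ∉ l.globalVars) :
    Rule.RespectedBy sem U I K ⟨H, nameLits F X Z Z' ++ distinctLits X ++ G⟩ ↔
      Rule.RespectedBy sem U I K ⟨H, countLit b F Y Z Z' :: G'⟩ := by
  classical
  set r : Rule ρ (Term σ ν) (List (Elem ρ (Term σ ν))) :=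
    ⟨H, nameLits F X Z Z' ++ distinctLits X ++ G⟩ with hr
  set s : Rule ρ (Term σ ν) (List (Elem ρ (Term σ ν))) := ⟨H, countLit b F Y Z Z' :: G'⟩ with hs
  have hsv : ∀ v, v ∈ s.globalVars ↔ v ∈ headVars H ∨ ∃ l ∈ G', v ∈ l.globalVars := by
    intro v
    simp [hs, Rule.globalVars, globalVars_countLit]
  have hrv : ∀ v ∈ r.globalVars, v ∈ s.globalVars ∨ v ∈ Set.range X := by
    rintro v (hv | ⟨l, hl, hv⟩)
    · exact .inl ((hsv v).2 (.inl hv))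
    · rcases List.mem_append.1 hl with hl | hl
      · rcases List.mem_append.1 hl with hl | hl
        · rcases mem_globalVars_nameLits hl hv with hv | hv
          exacts [.inr hv, .inl ((hsv v).2 (.inr (hZ v hv)))]
        · exact .inr (mem_globalVars_distinctLits hl hv)
      · exact .inl ((hsv v).2 (.inr ⟨l, (hGG' l).1 hl, hv⟩))
  have hsr : s.globalVars ⊆ r.globalVars := by
    intro v hv
    rcases (hsv v).1 hv with hv | ⟨l, hl, hv⟩
    · exact .inl hv
    · exact .inr ⟨l, List.mem_append_right _ ((hGG' l).2 hl), hv⟩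
  have hXs : ∀ i, X i ∉ s.globalVars := by
    intro i hi
    rcases (hsv _).1 hi with hi | ⟨l, hl, hi⟩
    exacts [hXH i hi, hXG i l hl (l.globalVars_subset_vars hi)]
  have hYs : Y ∉ s.globalVars := by
    intro hi
    rcases (hsv _).1 hi with hi | ⟨l, hl, hi⟩
    exacts [hYH hi, hYG l hl hi]
  have hZs : ∀ v, v ∈ Z ∨ v ∈ Z' → v ∈ s.globalVars := fun v hv => (hsv v).2 (.inr (hZ v hv))
  -- The `X i` may be global in `r` but are not in `s`. This does not affect the aggregates of `G'`,
  -- as no `X i` occurs in them, even inside their elements.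
  have hinst : ∀ θ θ' : ν → GTerm σ, (∀ v, θ' v ∈ U) → (∀ v ∈ s.globalVars, θ' v = θ v) →
      ∀ l ∈ G', l.inst U r.globalVars θ' = l.inst U s.globalVars θ := by
    intro θ θ' hθ' heq l hl
    refine Literal.inst_congr hsr heq (fun v hv => (hsv v).2 (.inr ⟨l, hl, hv⟩)) ?_ hθ'
    intro v hv hv' hvl
    rcases hrv v hv with hv | ⟨i, rfl⟩
    exacts [hv' hv, hXG i l hl hvl]
  have hbody : ∀ θ : ν → GTerm σ,
      (∀ l ∈ r.body, (l.inst U r.globalVars θ).Holds sem I K) ↔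
      ((∀ i, (⟨F, θ (X i) :: (Z ++ Z').map θ⟩ : GAtom σ ρ) ∈ K) ∧
        Function.Injective (θ ∘ X)) ∧ ∀ l ∈ G', (l.inst U r.globalVars θ).Holds sem I K := by
    intro θ
    simp only [← nameLits_hold (sem := sem) (U := U) (gv := r.globalVars) hK,
      ← distinctLits_hold (sem := sem) (U := U) (gv := r.globalVars) (I := I) (K := K)]
    simp only [← hGG', hr, List.forall_mem_append]
  constructor
  · intro h θ hθ
    rw [Rule.inst_respects]
    intro hb
    obtain ⟨hc, hG⟩ := List.forall_mem_cons.1 hb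
    obtain ⟨x, hx, hxK⟩ := (countLit_holds hK hθ hYs hZs).1 hc
    -- The `b` counted terms become the values of the `X i`; `θ` is kept elsewhere, in particular on
    -- all global variables of `s`.
    let θ' : ν → GTerm σ := fun v => if h : ∃ i, X i = v then x h.choose else θ v
    have hθX : ∀ i, θ' (X i) = x i := by
      intro i
      have hi : ∃ j, X j = X i := ⟨i, rfl⟩
      simp only [θ', dif_pos hi]
      rw [hX hi.choose_spec]
    have hθs : ∀ v, (∀ i, X i ≠ v) → θ' v = θ v := fun v hv => dif_neg (by simpa using hv)
    have hθg : ∀ v ∈ s.globalVars, θ' v = θ v := fun v hv =>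
      hθs v fun i hi => hXs i (hi ▸ hv)
    have hθ' : ∀ v, θ' v ∈ U := by
      intro v
      by_cases hv : ∃ i, X i = v
      · obtain ⟨i, rfl⟩ := hv
        exact hθX i ▸ (hxK i).1
      · rw [hθs v fun i hi => hv ⟨i, hi⟩]
        exact hθ v
    have hmap : (Z ++ Z').map θ' = (Z ++ Z').map θ :=
      List.map_congr_left fun v hv => hθg v (hZs v (List.mem_append.1 hv))
    have := Rule.inst_respects.1 (h θ' hθ') ((hbody θ').2 ⟨⟨fun i => ?_, ?_⟩, fun l hl => ?_⟩)
    · rwa [show r.head = H from rfl,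
        head_subst_congr fun v hv => hθg v ((hsv v).2 (.inl hv))] at this
    · rw [hθX, hmap]
      exact (hxK i).2
    · rwa [show θ' ∘ X = x from funext hθX]
    · rw [hinst θ θ' hθ' hθg l hl]
      exact hG l hl
  · intro h θ hθ
    rw [Rule.inst_respects, hbody]
    rintro ⟨⟨hF, hinj⟩, hG⟩
    have hs := Rule.inst_respects.1 (h θ hθ)
    refine hs (List.forall_mem_cons.2 ⟨?_, fun l hl => ?_⟩)
    · exact (countLit_holds hK hθ hYs hZs).2 ⟨θ ∘ X, hinj, fun i => ⟨hθ _, hF i⟩⟩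
    · rw [← hinst θ θ hθ (fun _ _ => rfl) l hl]
      exact hG l hl

end Replacement

/-! ### Atoms of a predicate symbol that does not occur do not matter. -/

section FreshPredicate

variable {σ ρ ν : Type*} {p : ρ} {k : ℕ}

/-- Ground conditions are instances of conditions that avoid `p/k`, so `R` and `S` need to agree on
such instances only. General `R` and `S` cover both truth and reduced truth. -/
theorem Count.tuples_congr {U : Set (GTerm σ)} {gv : Set ν} {θ : ν → GTerm σ}
    {c : Count (Term σ ν) (List (Elem ρ (Term σ ν)))}
    (hc : ∀ e ∈ c.elems, (p, k) ∉ e.preds) {R S : BasicLit ρ (GTerm σ) → Prop}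
    (hRS : ∀ (l : BasicLit ρ (Term σ ν)) (η : ν → GTerm σ), (p, k) ∉ l.atom.preds →
      (R (l.subst η) ↔ S (l.subst η))) :
    {t | ∃ e ∈ (c.inst U gv θ).elems, e.tuple = t ∧ ∀ l ∈ e.cond, R l} =
      {t | ∃ e ∈ (c.inst U gv θ).elems, e.tuple = t ∧ ∀ l ∈ e.cond, S l} := by
  ext t
  refine exists_congr fun e' => and_congr_right fun he' => and_congr_right fun _ => ?_
  obtain ⟨e, he, η, -, -, rfl⟩ := he'
  simp only [Elem.subst, List.forall_mem_map]
  exact forall₂_congr fun l hl => hRS l η fun h => hc e he ⟨l, hl, h⟩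

variable [LT σ]

theorem BasicAtom.sat_diff_atomsOf {a : BasicAtom ρ (Term σ ν)} (ha : (p, k) ∉ a.preds)
    {θ : ν → GTerm σ} {I : Set (GAtom σ ρ)} :
    (a.subst θ).Sat (I \ atomsOf p k) ↔ (a.subst θ).Sat I := by
  obtain a | ⟨rel, s, t⟩ := a
  · refine and_iff_left ?_
    rintro ⟨h₁, h₂⟩
    refine ha (Prod.ext h₁.symm ?_)
    simpa [Atom.subst] using h₂.symm
  · rfl

theorem BasicLit.sat_diff_atomsOf {l : BasicLit ρ (Term σ ν)} (hl : (p, k) ∉ l.atom.preds)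
    {θ : ν → GTerm σ} {I : Set (GAtom σ ρ)} :
    (l.subst θ).Sat (I \ atomsOf p k) ↔ (l.subst θ).Sat I := by
  obtain ⟨_ | _, a⟩ := l
  · exact BasicAtom.sat_diff_atomsOf hl
  · exact not_congr (BasicAtom.sat_diff_atomsOf hl)

theorem BasicLit.redSat_diff_atomsOf {l : BasicLit ρ (Term σ ν)} (hl : (p, k) ∉ l.atom.preds)
    {θ : ν → GTerm σ} {I K : Set (GAtom σ ρ)} :
    (l.subst θ).RedSat (I \ atomsOf p k) (K \ atomsOf p k) ↔ (l.subst θ).RedSat I K :=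
  and_congr (BasicLit.sat_diff_atomsOf hl)
    (imp_congr_right fun _ => BasicAtom.sat_diff_atomsOf hl)

theorem Literal.holds_diff_atomsOf {sem : Semantics} {l : Lit σ ρ ν} (hl : (p, k) ∉ l.preds)
    {U : Set (GTerm σ)} {gv : Set ν} {θ : ν → GTerm σ} {I K : Set (GAtom σ ρ)} :
    (l.inst U gv θ).Holds sem (I \ atomsOf p k) (K \ atomsOf p k) ↔
      (l.inst U gv θ).Holds sem I K := by
  obtain l | ⟨neg, c⟩ := l
  · cases sem
    · exact and_congr (BasicLit.sat_diff_atomsOf hl) (BasicLit.sat_diff_atomsOf hl)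
    · exact BasicLit.redSat_diff_atomsOf hl
  · have hc : ∀ e ∈ c.elems, (p, k) ∉ e.preds := fun e he h => hl ⟨e, he, h⟩
    have hS : ∀ J : Set (GAtom σ ρ), Count.Sat (J \ atomsOf p k) (c.inst U gv θ) ↔
        Count.Sat J (c.inst U gv θ) := by
      intro J
      rw [Count.Sat, Count.tuples_congr hc fun l η hl => BasicLit.sat_diff_atomsOf hl]
      rfl
    have hR : Count.RedSat (I \ atomsOf p k) (K \ atomsOf p k) (c.inst U gv θ) ↔
        Count.RedSat I K (c.inst U gv θ) := by
      rw [Count.RedSat, hS, Count.tuples_congr hc fun l η hl => BasicLit.redSat_diff_atomsOf hl]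
      rfl
    cases sem <;> cases neg <;>
      simp only [Literal.Holds, Literal.inst, Literal.Sat, Literal.RedSat, hS, hR]

theorem Rule.respectedBy_diff_atomsOf {sem : Semantics}
    {r : Rule ρ (Term σ ν) (List (Elem ρ (Term σ ν)))} (hr : (p, k) ∉ r.preds)
    {U : Set (GTerm σ)} {I K : Set (GAtom σ ρ)} :
    r.RespectedBy sem U (I \ atomsOf p k) (K \ atomsOf p k) ↔ r.RespectedBy sem U I K := by
  refine forall₂_congr fun θ _ => ?_
  rw [Rule.inst_respects, Rule.inst_respects]
  refine imp_congr (forall₂_congr fun l hl => Literal.holds_diff_atomsOf fun h =>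
    hr (.inr ⟨l, hl, h⟩)) (exists_congr fun h => and_congr_right fun hh => ?_)
  obtain ⟨⟨neg, a⟩, ha, rfl⟩ := Option.mem_map.1 hh
  have hmem : ∀ J : Set (GAtom σ ρ), a.subst θ ∈ J \ atomsOf p k ↔ a.subst θ ∈ J := by
    refine fun J => and_iff_left ?_
    rintro ⟨h₁, h₂⟩
    refine hr (.inl ⟨⟨neg, a⟩, ha, Prod.ext h₁.symm ?_⟩)
    simpa [Atom.subst] using h₂.symm
  cases sem <;> cases neg <;>
    simp only [HeadLit.Holds, HeadLit.Sat, HeadLit.RedSat, HeadLit.subst, hmem]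

theorem respects_diff_atomsOf {sem : Semantics} {P : Program σ ρ ν} (hP : (p, k) ∉ preds P)
    {I K : Set (GAtom σ ρ)} :
    Respects sem P (I \ atomsOf p k) (K \ atomsOf p k) ↔ Respects sem P I K := by
  rw [respects_iff, respects_iff]
  exact forall₂_congr fun r hr => Rule.respectedBy_diff_atomsOf fun h =>
    hP (Set.mem_biUnion hr h)

end FreshPredicate

/-! ### Explicit definition of the fresh predicate. -/

section Projection

/-- Minimality transfers along the addition of definitions `D` of the atoms in `A`. -/
theorem bijOn_diff_of_definition {α : Type*} {A : Set α} {D : Set α → Set α}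
    {R R' : Set α → Set α → Prop} (hmono : Monotone D) (hDA : ∀ K, D K ⊆ A)
    (hD : ∀ K, D (K \ A) = D K) (hR : ∀ I K, R (I \ A) (K \ A) ↔ R I K)
    (hR' : ∀ I K, K ⊆ I → (R' I K ↔ R I K ∧ D K ⊆ K)) :
    Set.BijOn (fun I => I \ A) {I | R' I I ∧ ∀ K ⊆ I, R' I K → I ⊆ K}
      {I | R I I ∧ ∀ K ⊆ I, R I K → I ⊆ K} := by
  have hdiff : ∀ K : Set α, Disjoint K A → (K ∪ D K) \ A = K := by
    intro K hK
    rw [Set.union_sdiff_distrib, Set.sdiff_eq_empty.2 (hDA K), Set.union_empty, hK.sdiff_eq_left]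
  have hDun : ∀ K : Set α, Disjoint K A → D (K ∪ D K) = D K := fun K hK => by
    rw [← hD, hdiff K hK]
  have hdis : ∀ I : Set α, Disjoint (I \ A) A := fun I => Set.disjoint_sdiff_left
  -- The set `(I \ A) ∪ D (I \ A)` lies in `I` and satisfies the conditions relative to `I`, so
  -- minimality forces equality. This gives injectivity.
  have hdet : ∀ I, (R' I I ∧ ∀ K ⊆ I, R' I K → I ⊆ K) → I = (I \ A) ∪ D (I \ A) := by
    rintro I ⟨hI, hmin⟩
    have h := (hR' I I subset_rfl).1 hI
    have hsub : (I \ A) ∪ D (I \ A) ⊆ I :=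
      Set.union_subset Set.sdiff_subset (by rw [hD]; exact h.2)
    refine (hmin _ hsub ((hR' I _ hsub).2 ⟨?_, ?_⟩)).antisymm hsub
    · rw [← hR, hdiff _ (hdis I), hR]
      exact h.1
    · rw [hDun _ (hdis I)]
      exact Set.subset_union_right
  refine ⟨?_, ?_, ?_⟩
  · rintro I ⟨hI, hmin⟩
    have h := (hR' I I subset_rfl).1 hI
    refine ⟨(hR I I).2 h.1, fun K hK hRK => ?_⟩
    have hKA : Disjoint K A := (hdis I).mono_left hK
    have hKI : K ⊆ I := hK.trans Set.sdiff_subset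
    -- A competitor `K` of `I \ A` is completed by its defined atoms to a competitor of `I`.
    have hsub : K ∪ D K ⊆ I := Set.union_subset hKI ((hmono hKI).trans h.2)
    have := hmin _ hsub ((hR' I _ hsub).2 ⟨?_, ?_⟩)
    · rw [← hdiff K hKA]
      exact Set.sdiff_subset_sdiff_left this
    · rw [← hR, hdiff K hKA]
      exact hRK
    · rw [hDun K hKA]
      exact Set.subset_union_right
  · intro I hI J hJ hIJ
    have hIJ' : I \ A = J \ A := hIJ
    rw [hdet I hI, hdet J hJ, hIJ']
  · rintro J ⟨hJ, hmin⟩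
    -- `R` ignores `A`, so `J \ A` is a competitor of `J`; minimality removes all atoms of `A` from
    -- `J`.
    have hJA : Disjoint J A := by
      have := hmin (J \ A) Set.sdiff_subset (by
        rw [← hR, Set.sdiff_sdiff, Set.union_self, hR]
        exact hJ)
      exact (hdis J).mono_left this
    refine ⟨J ∪ D J, ⟨(hR' _ _ subset_rfl).2 ⟨?_, ?_⟩, fun K hK hRK => ?_⟩, hdiff J hJA⟩
    · rw [← hR, hdiff J hJA]
      exact hJ
    · rw [hDun J hJA]
      exact Set.subset_union_right
    · obtain ⟨hRK, hDK⟩ := (hR' _ _ hK).1 hRK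
      rw [← hR, hdiff J hJA] at hRK
      have hJK : J ⊆ K \ A := hmin _ (by
        rw [← hdiff J hJA]
        exact Set.sdiff_subset_sdiff_left hK) hRK
      refine Set.union_subset (hJK.trans Set.sdiff_subset) (.trans ?_ hDK)
      rw [← hD K]
      exact hmono hJK

variable {σ ρ ν : Type*}

/-- The heads of the instances of `F'(Z) ← F(Y, Z, Z')` over `U` whose body is true in `K`. -/
def projection (U : Set (GTerm σ)) (F F' : ρ) (Y : ν) (Z Z' : List ν) (K : Set (GAtom σ ρ)) :
    Set (GAtom σ ρ) :=
  {a | ∃ θ : ν → GTerm σ, (∀ v, θ v ∈ U) ∧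
    (⟨F, θ Y :: (Z ++ Z').map θ⟩ : GAtom σ ρ) ∈ K ∧ a = ⟨F', Z.map θ⟩}

theorem projection_mono {U : Set (GTerm σ)} {F F' : ρ} {Y : ν} {Z Z' : List ν} :
    Monotone (projection U F F' Y Z Z') := by
  rintro K L hKL _ ⟨θ, hθ, hF, rfl⟩
  exact ⟨θ, hθ, hKL hF, rfl⟩

theorem projection_subset_atomsOf {U : Set (GTerm σ)} {F F' : ρ} {Y : ν} {Z Z' : List ν}
    {K : Set (GAtom σ ρ)} : projection U F F' Y Z Z' K ⊆ atomsOf F' Z.length := by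
  rintro _ ⟨θ, -, -, rfl⟩
  exact ⟨rfl, by simp⟩

/-- The body of the projection rule reads only atoms of `F`, whose symbol differs from that of `F'`;
the definition is not recursive. -/
theorem projection_diff_atomsOf {U : Set (GTerm σ)} {F F' : ρ} {Y : ν} {Z Z' : List ν}
    {K : Set (GAtom σ ρ)} (hF : (F', Z.length) ≠ (F, (Y :: (Z ++ Z')).length)) :
    projection U F F' Y Z Z' (K \ atomsOf F' Z.length) = projection U F F' Y Z Z' K := by
  refine (projection_mono Set.sdiff_subset).antisymm ?_
  rintro _ ⟨θ, hθ, hK, rfl⟩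
  refine ⟨θ, hθ, ⟨hK, ?_⟩, rfl⟩
  rintro ⟨h₁, h₂⟩
  exact hF (Prod.ext h₁.symm (by simpa using h₂.symm))

variable [LT σ]

theorem respectedBy_projRule_iff {sem : Semantics} {U : Set (GTerm σ)} {I K : Set (GAtom σ ρ)}
    (hK : K ⊆ I) {F F' : ρ} {Y : ν} {Z Z' : List ν} :
    (projRule F F' Y Z Z' : Rule ρ (Term σ ν) _).RespectedBy sem U I K ↔
      projection U F F' Y Z Z' K ⊆ K := by
  have key : ∀ θ : ν → GTerm σ,
      ((projRule F F' Y Z Z' : Rule ρ (Term σ ν) _).inst U θ).Respects sem I K ↔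
      ((⟨F, θ Y :: (Z ++ Z').map θ⟩ : GAtom σ ρ) ∈ K → (⟨F', Z.map θ⟩ : GAtom σ ρ) ∈ K) := by
    intro θ
    have hsub : (varAtom F' Z : Atom ρ (Term σ ν)).subst θ = ⟨F', Z.map θ⟩ := by
      simp [varAtom, Atom.subst, Function.comp_def, Term.subst]
    rw [Rule.inst_respects]
    refine imp_congr ?_ ?_
    · simp only [projRule, List.forall_mem_singleton, posLit_holds hK, List.map_cons]
    · cases sem <;>
        simp [projRule, HeadLit.Holds, HeadLit.Sat, HeadLit.RedSat, HeadLit.subst, hsub]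
      exact fun h => hK h
  constructor
  · rintro h _ ⟨θ, hθ, hF, rfl⟩
    exact (key θ).1 (h θ hθ) hF
  · exact fun h θ hθ => (key θ).2 fun hF => h ⟨θ, hθ, hF, rfl⟩

/-- As `b ≥ 1`, the body contains `F(X₁, Z, Z')`. Its truth in `K` puts `F'(Z)` into `K` by `hproj`,
and it already makes the variables of `Z` global. -/
theorem respectedBy_append_posLit_iff {sem : Semantics} {U : Set (GTerm σ)}
    {I K : Set (GAtom σ ρ)} (hK : K ⊆ I) {b : ℕ} (hb : 1 ≤ b)
    {H : Option (HeadLit ρ (Term σ ν))} {F F' : ρ} {X : Fin b → ν} {Z Z' : List ν}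
    {B : List (Lit σ ρ ν)} {Y : ν} (hY : Y ∉ Z ∧ Y ∉ Z')
    (hproj : projection U F F' Y Z Z' K ⊆ K) :
    Rule.RespectedBy sem U I K ⟨H, nameLits F X Z Z' ++ B ++ [posLit F' Z]⟩ ↔
      Rule.RespectedBy sem U I K ⟨H, nameLits F X Z Z' ++ B⟩ := by
  classical
  have hname : posLit F (X ⟨0, hb⟩ :: (Z ++ Z')) ∈ (nameLits F X Z Z' : List (Lit σ ρ ν)) :=
    List.mem_map.2 ⟨_, List.mem_finRange _, rfl⟩
  have hgv : Rule.globalVars (σ := σ) ⟨H, nameLits F X Z Z' ++ B ++ [posLit F' Z]⟩ =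
      Rule.globalVars ⟨H, nameLits F X Z Z' ++ B⟩ := by
    ext v
    refine or_congr_right ⟨?_, fun ⟨l, hl, hv⟩ => ⟨l, List.mem_append_left _ hl, hv⟩⟩
    rintro ⟨l, hl, hv⟩
    rcases List.mem_append.1 hl with hl | hl
    · exact ⟨l, hl, hv⟩
    · obtain rfl := List.mem_singleton.1 hl
      refine ⟨_, List.mem_append_left _ hname, mem_globalVars_posLit.2 ?_⟩
      exact List.mem_cons_of_mem _ (List.mem_append_left _ (mem_globalVars_posLit.1 hv))
  refine forall₂_congr fun θ hθ => ?_
  rw [Rule.inst_respects, Rule.inst_respects, hgv]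
  refine imp_congr_left ?_
  dsimp only
  rw [List.forall_mem_append (l₂ := [posLit F' Z])]
  refine and_iff_left_of_imp fun h => ?_
  rw [List.forall_mem_singleton, posLit_holds hK]
  have hF := (posLit_holds hK).1 (h _ (List.mem_append_left _ hname))
  have hmap : ∀ L : List ν, Y ∉ L → L.map (Function.update θ Y (θ (X ⟨0, hb⟩))) = L.map θ :=
    fun L hL => List.map_congr_left fun v hv =>
      Function.update_of_ne (by rintro rfl; exact hL hv) _ _
  -- The projection rule is instantiated with the value of the first `X i` for `Y`, which leaves `Z`
  -- and `Z'` unchanged because `Y` is in neither.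
  refine hproj ⟨Function.update θ Y (θ (X ⟨0, hb⟩)), fun v => ?_, ?_, by rw [hmap _ hY.1]⟩
  · by_cases hv : v = Y
    · subst hv
      simpa using hθ _
    · simpa [hv] using hθ v
  · rw [hmap _ (by simp [hY]), Function.update_self]
    exact hF

end Projection

end ASP

/-! ### The rewriting theorem. -/

theorem mainTheorem1 {σ ρ ν : Type*} [LinearOrder σ] (sem : ASP.Semantics)
    (P : ASP.Program σ ρ ν)
    (b : ℕ) (hb : 1 ≤ b)
    (H : Option (ASP.HeadLit ρ (ASP.Term σ ν))) (F : ρ)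
    (X : Fin b → ν) (Z Z' Z'' : List ν) (G : List (ASP.Lit σ ρ ν)) (Y : ν)
    -- the variables of the tuples
    (hX : Function.Injective X)
    (hXZ : ∀ i, X i ∉ Z ∧ X i ∉ Z' ∧ X i ∉ Z'')
    (hZZ' : Z.Disjoint Z') (hZZ'' : Z.Disjoint Z'') (hZ'Z'' : Z'.Disjoint Z'')
    -- `G = G(Z', Z'')`, outside aggregate elements; neither `H` nor `G` contains any `X i`
    (hG : ∀ v, (∃ l ∈ G, v ∈ l.globalVars) ↔ v ∈ Z' ∨ v ∈ Z'')
    (hXH : ∀ i, X i ∉ ASP.headVars H)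
    (hXG : ∀ i, ∀ l ∈ G, X i ∉ l.vars)
    -- the counted variable
    (hY : Y ∉ Z ∧ Y ∉ Z' ∧ Y ∉ Z'' ∧ Y ∉ ASP.headVars H)
    (hP : (⟨H, ASP.nameLits F X Z Z' ++ ASP.distinctLits X ++ G⟩ : ASP.Rule _ _ _) ∈ P) :
    (Z = [] →
      ASP.answerSets sem
        (ASP.replace P ⟨H, ASP.nameLits F X Z Z' ++ ASP.distinctLits X ++ G⟩
          {⟨H, ASP.countLit b F Y Z Z' :: G⟩})
      = ASP.answerSets sem P) ∧
    (Z ≠ [] → ∀ F' : ρ, (F', Z.length) ∉ ASP.preds P →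
      Set.BijOn (fun I => I \ ASP.atomsOf F' Z.length)
        (ASP.answerSets sem
          (ASP.replace P ⟨H, ASP.nameLits F X Z Z' ++ ASP.distinctLits X ++ G⟩
            {⟨H, ASP.nameLits F X Z Z' ++ ASP.distinctLits X ++ G ++ [ASP.posLit F' Z]⟩,
              ASP.projRule F F' Y Z Z'}))
        (ASP.answerSets sem P) ∧
      Set.BijOn (fun I => I \ ASP.atomsOf F' Z.length)
        (ASP.answerSets sem
          (ASP.replace P ⟨H, ASP.nameLits F X Z Z' ++ ASP.distinctLits X ++ G⟩
            {⟨H, ASP.countLit b F Y Z Z' :: ASP.posLit F' Z :: G⟩,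
              ASP.projRule F F' Y Z Z'}))
        (ASP.answerSets sem P)) := by

  set r : ASP.Rule ρ (ASP.Term σ ν) (List (ASP.Elem ρ (ASP.Term σ ν))) :=
    ⟨H, ASP.nameLits F X Z Z' ++ ASP.distinctLits X ++ G⟩ with hr
  have hrf : ∀ x, x ∈ r.functors ↔
      (∃ t ∈ ASP.headTerms H, x ∈ t.functors) ∨ ∃ l ∈ G, x ∈ l.functors := by
    intro x
    rw [ASP.Rule.mem_functors]
    refine or_congr_right ⟨?_, fun ⟨l, hl, hx⟩ => ⟨l, List.mem_append_right _ hl, hx⟩⟩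
    rintro ⟨l, hl, hx⟩
    rcases List.mem_append.1 hl with hl | hl
    · rcases List.mem_append.1 hl with hl | hl
      · exact absurd hx (ASP.notMem_functors_nameLits hl)
      · exact absurd hx (ASP.notMem_functors_distinctLits hl)
    · exact ⟨l, hl, hx⟩
  have hYG : ∀ l ∈ G, Y ∉ l.globalVars := fun l hl hv =>
    ((hG Y).1 ⟨l, hl, hv⟩).elim hY.2.1 hY.2.2.1
  refine ⟨?_, fun _ F' hF' => ?_⟩
  · rintro rfl
    have hU : ASP.herbrand (ASP.replace P r {⟨H, ASP.countLit b F Y [] Z' :: G⟩}) =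
        ASP.herbrand P := by
      refine ASP.herbrand_replace hP fun x => ?_
      rw [hrf]
      simp [ASP.Rule.mem_functors, ASP.notMem_functors_countLit]
    refine ASP.answerSets_congr fun I K hK => ?_
    rw [ASP.respects_replace_iff hU, ASP.respects_iff_of_mem hP]
    refine and_congr_right fun _ => ?_
    simp only [Set.mem_singleton_iff, forall_eq]
    refine (ASP.respectedBy_nameLits_iff_countLit hK hX
      (fun _ => Iff.rfl) (fun v hv => (hG v).2 (.inl (hv.resolve_left (by simp))))
      hXH hXG hY.2.2.2 hYG).symm
  · set r' : ASP.Rule ρ (ASP.Term σ ν) (List (ASP.Elem ρ (ASP.Term σ ν))) :=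
      ⟨H, ASP.nameLits F X Z Z' ++ ASP.distinctLits X ++ G ++ [ASP.posLit F' Z]⟩ with hr'
    set r'' : ASP.Rule ρ (ASP.Term σ ν) (List (ASP.Elem ρ (ASP.Term σ ν))) :=
      ⟨H, ASP.countLit b F Y Z Z' :: ASP.posLit F' Z :: G⟩ with hr''
    have hU' : ASP.herbrand (ASP.replace P r {r', ASP.projRule F F' Y Z Z'}) =
        ASP.herbrand P := by
      refine ASP.herbrand_replace hP fun x => ?_
      have : x ∈ r'.functors ↔ x ∈ r.functors := by
        rw [hrf, ASP.Rule.mem_functors]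
        constructor
        · rintro (hx | ⟨l, hl, hx⟩)
          · exact .inl hx
          · rcases List.mem_append.1 hl with hl | hl
            · exact (hrf x).1 (ASP.Rule.mem_functors.2 (.inr ⟨l, hl, hx⟩))
            · obtain rfl := List.mem_singleton.1 hl
              exact absurd hx ASP.notMem_functors_posLit
        · exact Or.imp_right fun ⟨l, hl, hx⟩ =>
            ⟨l, List.mem_append_left _ (List.mem_append_right _ hl), hx⟩
      simp [ASP.notMem_functors_projRule, this]
    have hU'' : ASP.herbrand (ASP.replace P r {r'', ASP.projRule F F' Y Z Z'}) =
        ASP.herbrand P := by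
      refine ASP.herbrand_replace hP fun x => ?_
      have : x ∈ r''.functors ↔ x ∈ r.functors := by
        rw [hrf]
        simp [hr'', ASP.Rule.mem_functors, ASP.notMem_functors_countLit,
          ASP.notMem_functors_posLit]
      simp [ASP.notMem_functors_projRule, this]
    have hP'P'' : ASP.answerSets sem (ASP.replace P r {r'', ASP.projRule F F' Y Z Z'}) =
        ASP.answerSets sem (ASP.replace P r {r', ASP.projRule F F' Y Z Z'}) := by
      refine ASP.answerSets_congr fun I K hK => ?_
      rw [ASP.respects_replace_iff hU', ASP.respects_replace_iff hU'']
      refine and_congr_right fun _ => ?_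
      simp only [Set.mem_insert_iff, Set.mem_singleton_iff, forall_eq_or_imp, forall_eq]
      refine and_congr_left fun _ => ?_
      -- The literal `F'(Z)` is treated as part of `G`; it stands last in one rule and first in the
      -- other, hence only membership is compared.
      rw [hr', List.append_assoc _ G]
      refine (ASP.respectedBy_nameLits_iff_countLit hK hX
        (fun l => ?_) (fun v hv => ?_) hXH (fun i l hl => ?_) hY.2.2.2 fun l hl => ?_).symm
      · simp [or_comm]
      · rcases hv with hv | hv
        · exact ⟨_, List.mem_cons_self, ASP.mem_globalVars_posLit.2 hv⟩
        · obtain ⟨l, hl, hvl⟩ := (hG v).2 (.inl hv)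
          exact ⟨l, List.mem_cons_of_mem _ hl, hvl⟩
      · rcases List.mem_cons.1 hl with rfl | hl
        · exact fun h => (hXZ i).1 (ASP.mem_globalVars_posLit.1 h)
        · exact hXG i l hl
      · rcases List.mem_cons.1 hl with rfl | hl
        · exact fun h => hY.1 (ASP.mem_globalVars_posLit.1 h)
        · exact hYG l hl
    rw [hP'P'', and_self]
    have hset : ∀ Q : ASP.Program σ ρ ν, ASP.answerSets sem Q =
        {I | ASP.Respects sem Q I I ∧ ∀ K ⊆ I, ASP.Respects sem Q I K → I ⊆ K} :=
      fun Q => Set.ext fun I => ASP.mem_answerSets_iff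
    rw [hset, hset]
    -- Since `b ≥ 1`, the symbol of `F` occurs in `r` and so in `P`; a fresh symbol differs from it.
    have hFP : (F', Z.length) ≠ (F, (Y :: (Z ++ Z')).length) := by
      intro h
      refine hF' (Set.mem_biUnion hP (.inr ⟨ASP.posLit F (X ⟨0, hb⟩ :: (Z ++ Z')), ?_, ?_⟩))
      · refine List.mem_append_left _ (List.mem_append_left _ ?_)
        exact List.mem_map.2 ⟨_, List.mem_finRange _, rfl⟩
      · rw [h]
        simp [ASP.Literal.preds, ASP.posLit, ASP.BasicAtom.preds, ASP.varAtom]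
    refine ASP.bijOn_diff_of_definition
      (D := ASP.projection (ASP.herbrand P) F F' Y Z Z') ASP.projection_mono
      (fun _ => ASP.projection_subset_atomsOf) (fun _ => ASP.projection_diff_atomsOf hFP)
      (fun _ _ => ASP.respects_diff_atomsOf hF') fun I K hK => ?_
    rw [ASP.respects_replace_iff hU', ASP.respects_iff_of_mem hP, and_assoc]
    refine and_congr_right fun _ => ?_
    simp only [Set.mem_insert_iff, Set.mem_singleton_iff, forall_eq_or_imp, forall_eq]
    rw [ASP.respectedBy_projRule_iff hK]
    refine and_congr_left fun hproj => ?_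
    rw [hr', hr, List.append_assoc _ (ASP.distinctLits X) G]
    exact ASP.respectedBy_append_posLit_iff hK hb ⟨hY.1, hY.2.1⟩ hproj
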